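/- Let $\mathcal H$ be a complex Hilbert space with $D:=\dim\mathcal H<\infty$ and unit sphere $\mathbb S(\mathcal H)$, let $\mathcal H_{\mathrm{eq}}\subseteq\mathcal H$ be any subspace, $P_{\mathrm{eq}}$ the orthogonal projection onto it, and $P_{\mathrm{neq}}:=I-P_{\mathrm{eq}}$. Let $H_0$ be a self-adjoint operator on $\mathcal H$ and let $\varepsilon>0$; assume that $H_0$ has an orthonormal eigenbasis $(\phi_k)_{k=1}^{D}$ with $\|P_{\mathrm{neq}}\phi_k\|^2<\varepsilon$ for all $k$. Let $V$ be a random self-adjoint operator on $\mathcal H$ whose distribution is continuous (i.e. absolutely continuous with respect to Lebesgue measure on the real vector space of self-adjoint operators) and invariant under conjugation with all unitaries commuting with $H_0$. For $\lambda\in\mathbb R$ let $H:=H_0+\lambda V$, and for $\psi_0\in\mathbb S(\mathcal H)$ let $\psi_t:=e^{-iHt}\psi_0$. Then for all $\delta,\delta'>0$ there exists $\lambda_0>0$ such that for all $\lambda\in(0,\lambda_0)$ and all $\psi_0\in\mathbb S(\mathcal H)$ the following holds: for $(1-\delta)$-most $V$, for $(1-\delta')$-most $t\in[0,\infty)$,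 $$\|P_{\mathrm{neq}}\psi_t\|^2<\frac{3\varepsilon}{\delta\delta'}.$$ Here "for $(1-\delta)$-most $V$" means with probability at least $1-\delta$ with respect to the distribution of $V$, and "$S(t)$ holds for $(1-\delta')$-most $t\in[0,\infty)$" means $$\liminf_{T\to\infty}\frac1T\bigl|\{t\in[0,T]:S(t)\text{ holds}\}\bigr|\ge 1-\delta',$$ with $|\cdot|$ denoting Lebesgue measure. -/

import Mathlib

open MeasureTheory Filter Set

noncomputable section

namespace Thermalization

/-- `S x` holds for `(1 - δ)`-most `x` with respect to the probability measure `μ`: the event `S`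
has probability at least `1 - δ`. To be safe about measurability, a measurable set of points
satisfying `S` with probability at least `1 - δ` is required; for measurable `S` this is
`1 - δ ≤ μ {x | S x}` (see `forMost_iff`). -/
def ForMost {X : Type*} [MeasurableSpace X] (μ : Measure X) (δ : ℝ) (S : X → Prop) : Prop :=
  ∃ A : Set X, MeasurableSet A ∧ (∀ x ∈ A, S x) ∧ ENNReal.ofReal (1 - δ) ≤ μ A

theorem forMost_iff {X : Type*} [MeasurableSpace X] (μ : Measure X) (δ : ℝ) (S : X → Prop)
    (hS : MeasurableSet {x | S x}) :
    ForMost μ δ S ↔ ENNReal.ofReal (1 - δ) ≤ μ {x | S x} :=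
  ⟨fun ⟨_, _, hA, h⟩ => h.trans (measure_mono hA), fun h => ⟨_, hS, fun _ hx => hx, h⟩⟩

/-- `S t` holds for `(1 - δ)`-most `t ∈ [0, ∞)`:
`liminf_{T → ∞} |{t ∈ [0, T] : S t}| / T ≥ 1 - δ`. -/
def ForMostTimes (δ : ℝ) (S : ℝ → Prop) : Prop :=
  1 - δ ≤ liminf (fun T : ℝ => volume.real {t : ℝ | t ∈ Icc 0 T ∧ S t} / T) atTop

variable {H : Type*} [NormedAddCommGroup H] [InnerProductSpace ℂ H] [FiniteDimensional ℂ H]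
  [CompleteSpace H]

/-- Conjugation `V ↦ U V U†` of a self-adjoint operator by a unitary `U`. -/
def conj (U : unitary (H →L[ℂ] H)) (V : selfAdjoint (H →L[ℂ] H)) : selfAdjoint (H →L[ℂ] H) :=
  ⟨(U : H →L[ℂ] H) * V * star (U : H →L[ℂ] H), V.2.conjugate (U : H →L[ℂ] H)⟩

/-- The law `μ` on the finite-dimensional real vector space of self-adjoint operators is
continuous, i.e. absolutely continuous with respect to Lebesgue (Haar) measure on that space.
All such measures are multiples of each other, so it does not matter which one is used. -/
def ContinuousLaw (μ : Measure (selfAdjoint (H →L[ℂ] H))) : Prop :=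
  ∃ ν : Measure (selfAdjoint (H →L[ℂ] H)), ν.IsAddHaarMeasure ∧ μ ≪ ν

/-- The law `μ` is invariant under conjugation with all unitaries commuting with `H₀`. -/
def InvariantLaw (H₀ : H →L[ℂ] H) (μ : Measure (selfAdjoint (H →L[ℂ] H))) : Prop :=
  ∀ U : unitary (H →L[ℂ] H), Commute (U : H →L[ℂ] H) H₀ → μ.map (conj U) = μ

/-- The state `ψ_t = exp(-i A t) ψ₀` at time `t`, evolving with Hamiltonian `A`. -/
def evolve (A : H →L[ℂ] H) (t : ℝ) (ψ₀ : H) : H :=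
  NormedSpace.exp ((-(Complex.I * (t : ℂ))) • A) ψ₀

/-- The projection `P_neq = I - P_eq`, with `P_eq` the orthogonal projection onto `Heq`. -/
def Pneq (Heq : Submodule ℂ H) : H →L[ℂ] H := 1 - Heq.starProjection

end Thermalization

end

/-! No smallness of the perturbation is needed: the bound holds for every nonzero coupling. For
almost every `V` the spectrum of `H₀ + lam V` is simple, because the determinant of the Krylov
vectors of a fixed vector does not vanish identically in `V` (`ae_selfAdjoint_krylov_det_ne_zero`).
With eigenbasis `b`, the long-time average of `‖P ψ_t‖²` is then `∑ k, |⟪b k, ψ⟫|² ‖P (b k)‖²`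
(`tendsto_timeAvg`).

If `U` is diagonal in `φ`, it commutes with `H₀`, so conjugating `V` by `U` preserves the law and
turns `b` into `U b`. The mean over `V` is therefore unchanged by first averaging over finitely many
diagonal unitaries whose entries are fourth roots of unity. That average is a fourth moment of the
phases, in which only two pairings survive; each contributes at most `ε`, so the mean is at most `2
ε` (`sum_phase_timeAvg_le`, `lintegral_longTimeAvg_le`). Markov's inequality in `V`, then in `t`,
concludes. -/

noncomputable section

namespace Thermalization

open scoped InnerProductSpace Topology

/-! ### Almost sure simplicity of the spectrum. -/

section

variable {H : Type*} [NormedAddCommGroup H] [InnerProductSpace ℂ H] {ι : Type*} [Fintype ι]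

/-- The operator that is diagonal in the orthonormal basis `φ`, with diagonal entries `c`. -/
def diagOp (φ : OrthonormalBasis ι ℂ H) (c : ι → ℂ) : H →L[ℂ] H :=
  ∑ k, c k • (innerSL ℂ (φ k)).smulRight (φ k)

theorem diagOp_apply (φ : OrthonormalBasis ι ℂ H) (c : ι → ℂ) (x : H) :
    diagOp φ c x = ∑ k, c k • ⟪φ k, x⟫_ℂ • φ k := by
  simp [diagOp]

theorem diagOp_basis (φ : OrthonormalBasis ι ℂ H) (c : ι → ℂ) (k : ι) :
    diagOp φ c (φ k) = c k • φ k := by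
  classical
  simp [diagOp_apply, OrthonormalBasis.inner_eq_ite]

theorem clm_ext_basis (φ : OrthonormalBasis ι ℂ H) {A B : H →L[ℂ] H}
    (h : ∀ k, A (φ k) = B (φ k)) : A = B := by
  apply ContinuousLinearMap.coe_injective
  exact φ.toBasis.ext fun k => by simpa using h k

theorem diagOp_mul (φ : OrthonormalBasis ι ℂ H) (c d : ι → ℂ) :
    diagOp φ c * diagOp φ d = diagOp φ (c * d) :=
  clm_ext_basis φ fun k => by
    simp [diagOp_basis, smul_smul, mul_comm]

theorem diagOp_one (φ : OrthonormalBasis ι ℂ H) : diagOp φ 1 = 1 :=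
  clm_ext_basis φ fun k => by simp [diagOp_basis]

theorem star_diagOp [CompleteSpace H] (φ : OrthonormalBasis ι ℂ H) (c : ι → ℂ) :
    star (diagOp φ c) = diagOp φ (star c) := by
  rw [ContinuousLinearMap.star_eq_adjoint]
  symm
  rw [ContinuousLinearMap.eq_adjoint_iff]
  intro x y
  simp only [diagOp_apply, sum_inner, inner_sum, inner_smul_left, inner_smul_right, Pi.star_apply]
  refine Finset.sum_congr rfl fun k _ => ?_
  rw [← inner_conj_symm x (φ k)]
  simp only [RCLike.star_def, starRingEnd_self_apply]
  ring

theorem diagOp_pow_basis (φ : OrthonormalBasis ι ℂ H) (c : ι → ℂ) (n : ℕ) (k : ι) :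
    (diagOp φ c ^ n) (φ k) = c k ^ n • φ k := by
  induction n with
  | zero => simp
  | succ n ih => simp [pow_succ, diagOp_basis, ih, smul_smul, mul_comm]

/-- The matrix of the Krylov vectors `w, A w, A² w, …` in the basis `φ`. -/
def krylov {n : ℕ} (φ : OrthonormalBasis (Fin n) ℂ H) (w : H) (A : H →L[ℂ] H) :
    Matrix (Fin n) (Fin n) ℂ :=
  Matrix.of fun i j => ⟪φ i, (A ^ (j : ℕ)) w⟫_ℂ

/-- The coordinates of `u` give a nontrivial linear relation among the rows of the matrix. -/
theorem krylov_det_eq_zero {n : ℕ} (φ : OrthonormalBasis (Fin n) ℂ H) (w : H) (A : H →L[ℂ] H)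
    (u : H) (hu : u ≠ 0) (h : ∀ j : ℕ, ⟪u, (A ^ j) w⟫_ℂ = 0) : (krylov φ w A).det = 0 := by
  refine Matrix.exists_vecMul_eq_zero_iff.1 ⟨fun i => ⟪u, φ i⟫_ℂ, ?_, ?_⟩
  · intro h0
    refine hu (?_)
    rw [← φ.sum_repr u]
    refine Finset.sum_eq_zero fun i _ => ?_
    have := congrFun h0 i
    rw [φ.repr_apply_apply, ← inner_conj_symm, this, Pi.zero_apply, map_zero, zero_smul]
  · ext j
    simp only [Matrix.vecMul, dotProduct, krylov, Matrix.of_apply, Pi.zero_apply]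
    rw [φ.sum_inner_mul_inner, h]

theorem inner_pow_of_eigenvector [CompleteSpace H] {A : H →L[ℂ] H} (hA : IsSelfAdjoint A) {v : H}
    {e : ℝ} (hv : A v = (e : ℂ) • v) (j : ℕ) (w : H) :
    ⟪v, (A ^ j) w⟫_ℂ = (e : ℂ) ^ j * ⟪v, w⟫_ℂ := by
  induction j generalizing w with
  | zero => simp
  | succ j ih =>
    rw [pow_succ, mul_apply_eq_comp, ih]
    have h : ⟪A v, w⟫_ℂ = ⟪v, A w⟫_ℂ := hA.isSymmetric v w
    rw [← h, hv, inner_smul_left]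
    simp
    ring

/-- A self-adjoint operator with a cyclic vector has no repeated eigenvalue. -/
theorem eigenvalues_injective_of_krylov [CompleteSpace H] {n : ℕ}
    (φ b : OrthonormalBasis (Fin n) ℂ H) (w : H) {A : H →L[ℂ] H} (hA : IsSelfAdjoint A)
    (h : (krylov φ w A).det ≠ 0) (e : Fin n → ℝ) (hb : ∀ k, A (b k) = (e k : ℂ) • b k) :
    Function.Injective e := by
  intro k l hkl
  by_contra hne
  have hv (α β : ℂ) : A (α • b k + β • b l) = (e k : ℂ) • (α • b k + β • b l) := by
    rw [map_add, map_smul, map_smul, hb, hb, hkl, smul_add, smul_comm α, smul_comm β]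
  by_cases hk : ⟪b k, w⟫_ℂ = 0
  · exact h (krylov_det_eq_zero φ w A (b k) (b.orthonormal.ne_zero k) fun j => by
      rw [inner_pow_of_eigenvector hA (hb k), hk, mul_zero])
  -- In a two-dimensional eigenspace some nonzero `u` is orthogonal to `w`; being an eigenvector, it
  -- is orthogonal to every `A ^ j w`.
  · set u : H := starRingEnd ℂ ⟪b l, w⟫_ℂ • b k + (-starRingEnd ℂ ⟪b k, w⟫_ℂ) • b l with hu
    refine h (krylov_det_eq_zero φ w A u ?_ fun j => ?_)
    · intro h0
      have h1 : ⟪b l, u⟫_ℂ = 0 := by rw [h0, inner_zero_right]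
      rw [hu, inner_add_right, inner_smul_right, inner_smul_right, b.inner_eq_zero (Ne.symm hne),
        b.inner_eq_one] at h1
      simp at h1
      exact hk (by rw [← inner_conj_symm, h1, map_zero])
    · rw [inner_pow_of_eigenvector hA (hv _ _), inner_add_left, inner_smul_left, inner_smul_left]
      simp
      right
      ring

theorem krylov_det_smul {n : ℕ} (φ : OrthonormalBasis (Fin n) ℂ H) (w : H) (A : H →L[ℂ] H)
    (r : ℂ) : (krylov φ w (r • A)).det = (∏ j : Fin n, r ^ (j : ℕ)) * (krylov φ w A).det := by
  rw [← Matrix.det_mul_row]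
  congr 1
  ext i j
  simp [krylov, smul_pow]

theorem krylov_det_diagOp_ne_zero {n : ℕ} (φ : OrthonormalBasis (Fin n) ℂ H) (c : Fin n → ℂ)
    (hc : Function.Injective c) : (krylov φ (∑ k, φ k) (diagOp φ c)).det ≠ 0 := by
  have : krylov φ (∑ k, φ k) (diagOp φ c) = Matrix.vandermonde c := by
    ext i j
    simp only [krylov, Matrix.of_apply, Matrix.vandermonde_apply, map_sum, diagOp_pow_basis,
      inner_sum, inner_smul_right, OrthonormalBasis.inner_eq_ite]
    simp
  rw [this]
  exact Matrix.det_vandermonde_ne_zero_iff.2 hc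

theorem continuous_krylov_det {n : ℕ} (φ : OrthonormalBasis (Fin n) ℂ H) (w : H) :
    Continuous fun A : H →L[ℂ] H => (krylov φ w A).det := by
  refine Continuous.matrix_det ?_
  refine continuous_matrix fun i j => ?_
  simp only [krylov, Matrix.of_apply]
  fun_prop

theorem analytic_krylov_det {n : ℕ} (φ : OrthonormalBasis (Fin n) ℂ H) (w : H)
    (B C : H →L[ℂ] H) :
    AnalyticOnNhd ℝ (fun s : ℝ => (krylov φ w (B + (s : ℂ) • C)).det) univ := by
  intro s _
  have hs : AnalyticAt ℝ (fun s : ℝ => B + (s : ℂ) • C) s :=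
    analyticAt_const.add
      (((ContinuousLinearMap.toSpanSingleton ℝ C).analyticAt s).congr (.of_forall fun x => by simp))
  simp only [Matrix.det_apply]
  refine Finset.analyticAt_fun_sum _ fun σ _ => ?_
  refine AnalyticAt.const_smul (Finset.analyticAt_fun_prod _ fun j _ => ?_)
  let L : (H →L[ℂ] H) →L[ℝ] ℂ :=
    ((innerSL ℂ (φ (σ j))).comp (ContinuousLinearMap.apply ℂ H w)).restrictScalars ℝ
  exact (L.analyticAt _).comp (hs.pow j)

/-- The determinant is analytic in `s`, so its zeros are negligible unless it vanishes identically.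
Its behaviour as `s → ∞` is governed by `C` alone, which excludes the latter. -/
theorem ae_krylov_det_ne_zero {n : ℕ} (φ : OrthonormalBasis (Fin n) ℂ H) (w : H)
    (B C : H →L[ℂ] H) (hC : (krylov φ w C).det ≠ 0) :
    ∀ᵐ s : ℝ, (krylov φ w (B + (s : ℂ) • C)).det ≠ 0 := by
  rcases (analytic_krylov_det φ w B C).eqOn_zero_or_eventually_ne_zero_of_preconnected
    isPreconnected_univ with h | h
  · exfalso
    apply hC
    have hcont : Continuous fun r : ℝ => (krylov φ w ((r : ℂ) • B + C)).det :=
      (continuous_krylov_det φ w).comp (by fun_prop)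
    -- By homogeneity, `s = r⁻¹` carries the zeros over to `r • B + C` for `r ≠ 0`; continuity then
    -- reaches `r = 0`.
    have hz : ∀ r : ℝ, r ≠ 0 → (krylov φ w ((r : ℂ) • B + C)).det = 0 := by
      intro r hr
      have hr' : (r : ℂ) ≠ 0 := by exact_mod_cast hr
      have : (r : ℂ) • B + C = (r : ℂ) • (B + ((r⁻¹ : ℝ) : ℂ) • C) := by
        simp [smul_smul, hr']
      have h0 := h (mem_univ r⁻¹)
      simp only [Pi.zero_apply] at h0
      rw [this, krylov_det_smul, h0, mul_zero]
    have := (isClosed_singleton.preimage hcont).closure_subset_iff.2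
      (show ({0}ᶜ : Set ℝ) ⊆ (fun r : ℝ => (krylov φ w ((r : ℂ) • B + C)).det) ⁻¹' {0} from
        fun r hr => hz r hr)
    have h0 := this (by rw [(dense_compl_singleton (0 : ℝ)).closure_eq]; exact mem_univ 0)
    simpa using h0
  · have := ae_restrict_le_codiscreteWithin (μ := volume) (MeasurableSet.univ (α := ℝ)) h
    rwa [Measure.restrict_univ] at this

instance [CompleteSpace H] [FiniteDimensional ℂ H] :
    LocallyCompactSpace (selfAdjoint (H →L[ℂ] H)) := by
  have : LocallyCompactSpace (H →L[ℂ] H) := locallyCompact_of_proper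
  have : IsClosed ((selfAdjoint (H →L[ℂ] H) : Set (H →L[ℂ] H))) :=
    isClosed_eq continuous_star continuous_id
  exact this.isClosedEmbedding_subtypeVal.locallyCompactSpace

theorem ae_selfAdjoint_krylov_det_ne_zero [CompleteSpace H] [FiniteDimensional ℂ H] {n : ℕ}
    (φ : OrthonormalBasis (Fin n) ℂ H) (H₀ : H →L[ℂ] H) {lam : ℝ} (hlam : lam ≠ 0)
    {μ : Measure (selfAdjoint (H →L[ℂ] H))} (hμ : ContinuousLaw μ) :
    ∀ᵐ V : selfAdjoint (H →L[ℂ] H) ∂μ,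
      (krylov φ (∑ k, φ k) (H₀ + (lam : ℂ) • (V : H →L[ℂ] H))).det ≠ 0 := by
  obtain ⟨ν, hν, hac⟩ := hμ
  refine hac.ae_le ?_
  -- Distinct real entries: `W` is self-adjoint and its Krylov matrix is an invertible Vandermonde
  -- matrix.
  let c : Fin n → ℂ := fun k => (k : ℕ)
  let W : selfAdjoint (H →L[ℂ] H) := ⟨diagOp φ c, by
    rw [selfAdjoint.mem_iff, star_diagOp]; congr 1; ext k; simp [c]⟩
  have hcont : Continuous fun V : selfAdjoint (H →L[ℂ] H) =>
      (krylov φ (∑ k, φ k) (H₀ + (lam : ℂ) • (V : H →L[ℂ] H))).det :=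
    (continuous_krylov_det φ _).comp (by fun_prop)
  have hms : MeasurableSet {V : selfAdjoint (H →L[ℂ] H) |
      (krylov φ (∑ k, φ k) (H₀ + (lam : ℂ) • (V : H →L[ℂ] H))).det ≠ 0} :=
    (isOpen_compl_singleton.preimage hcont).measurableSet
  -- Fubini along the lines `V + s W`: a property valid for almost every `s` on each line holds
  -- almost everywhere.
  refine ae_mem_of_ae_add_linearMap_mem (𝕜 := ℝ) (E := ℝ) (F := selfAdjoint (H →L[ℂ] H))
    (LinearMap.toSpanSingleton ℝ _ W) volume ν hms fun V => ?_
  have hC : (krylov φ (∑ k, φ k) ((lam : ℂ) • diagOp φ c)).det ≠ 0 := by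
    rw [krylov_det_smul]
    refine mul_ne_zero (Finset.prod_ne_zero_iff.2 fun j _ => pow_ne_zero _ (by exact_mod_cast hlam))
      (krylov_det_diagOp_ne_zero φ c ?_)
    intro k l hkl
    simpa [c, Fin.ext_iff] using hkl
  filter_upwards [ae_krylov_det_ne_zero φ (∑ k, φ k) (H₀ + (lam : ℂ) • (V : H →L[ℂ] H)) _ hC]
    with s hs
  have : H₀ + (lam : ℂ) • ((V + s • W : selfAdjoint (H →L[ℂ] H)) : H →L[ℂ] H) =
      H₀ + (lam : ℂ) • (V : H →L[ℂ] H) + (s : ℂ) • (lam : ℂ) • diagOp φ c := by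
    have hL : ((s • W : selfAdjoint (H →L[ℂ] H)) : H →L[ℂ] H) = (s : ℂ) • diagOp φ c := by
      simp [W]
    rw [AddSubgroup.coe_add, hL, smul_add, smul_comm (lam : ℂ) (s : ℂ), add_assoc]
  change (krylov φ _ (H₀ + (lam : ℂ) • ((V + s • W : selfAdjoint (H →L[ℂ] H)) : H →L[ℂ] H))).det ≠ 0
  rwa [this]

end

/-! ### Long-time averages and Markov's inequality in time. -/

section

variable {H : Type*} [NormedAddCommGroup H] [InnerProductSpace ℂ H] [CompleteSpace H]

theorem evolve_eigenvector (A : H →L[ℂ] H) {v : H} {e : ℂ} (hv : A v = e • v) (t : ℝ) :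
    evolve A t v = Complex.exp (-(Complex.I * t) * e) • v := by
  have h := NormedSpace.exp_series_hasSum_exp' (𝕂 := ℂ) ((-(Complex.I * (t : ℂ))) • A)
  have h1 := h.mapL (ContinuousLinearMap.apply ℂ H v)
  have h2 := (NormedSpace.exp_series_hasSum_exp' (𝕂 := ℂ) (-(Complex.I * (t : ℂ)) * e)).smul_const v
  rw [← Complex.exp_eq_exp_ℂ] at h2
  have hpow (n : ℕ) : (((-(Complex.I * (t : ℂ))) • A) ^ n) v =
      (-(Complex.I * (t : ℂ)) * e) ^ n • v := by
    induction n with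
    | zero => simp
    | succ n ih =>
      rw [pow_succ, mul_apply_eq_comp, smul_apply, hv, smul_smul, map_smul, ih,
        smul_smul, pow_succ, mul_comm]
  refine h1.unique ?_
  convert h2 using 2 with n
  simp only [ContinuousLinearMap.apply_apply, smul_apply, hpow, smul_smul,
    smul_eq_mul]

theorem continuous_evolve : Continuous fun p : (H →L[ℂ] H) × ℝ × H => evolve p.1 p.2.1 p.2.2 := by
  let _ : NormedAlgebra ℚ (H →L[ℂ] H) := .restrictScalars ℚ ℂ _
  have := NormedSpace.exp_continuous (𝔸 := H →L[ℂ] H)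
  unfold evolve
  fun_prop

/-- The average of `‖P ψ_t‖²` over `t ∈ [0, T]`. -/
def timeAvg (P A : H →L[ℂ] H) (ψ : H) (T : ℝ) : ℝ :=
  (∫ t in (0 : ℝ)..T, ‖P (evolve A t ψ)‖ ^ 2) / T

theorem tendsto_avg_exp (ω : ℝ) :
    Tendsto (fun T : ℝ => (∫ t in (0 : ℝ)..T, Complex.exp (ω * Complex.I * t)) / T) atTop
      (𝓝 (if ω = 0 then 1 else 0)) := by
  split_ifs with h
  · refine tendsto_const_nhds.congr' ?_
    filter_upwards [eventually_gt_atTop 0] with T hT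
    have : (T : ℂ) ≠ 0 := by exact_mod_cast hT.ne'
    simp [h, this]
  · have hc : (ω : ℂ) * Complex.I ≠ 0 := by simp [h]
    simp only [integral_exp_mul_complex hc]
    rw [tendsto_zero_iff_norm_tendsto_zero]
    refine squeeze_zero' (.of_forall fun _ => norm_nonneg _) ?_
      ((tendsto_const_nhds (x := 2 / |ω|)).div_atTop tendsto_id)
    filter_upwards [eventually_gt_atTop 0] with T hT
    simp only [norm_div, id, Complex.norm_real, Real.norm_eq_abs, abs_of_pos hT, norm_mul,
      Complex.norm_I, mul_one]
    gcongr
    refine (norm_sub_le _ _).trans ?_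
    have (x : ℝ) : ‖Complex.exp (ω * Complex.I * x)‖ = 1 := by
      rw [show (ω : ℂ) * Complex.I * x = ((ω * x : ℝ) : ℂ) * Complex.I by push_cast; ring,
        Complex.norm_exp_ofReal_mul_I]
    rw [this, this]
    norm_num

/-- Expanding the square yields terms oscillating at frequencies `e k - e l`; as the eigenvalues are
distinct, only the diagonal terms survive averaging. -/
theorem tendsto_timeAvg {ι : Type*} [Fintype ι] (P A : H →L[ℂ] H) (ψ : H)
    (b : OrthonormalBasis ι ℂ H) (e : ι → ℝ) (he : Function.Injective e)
    (hb : ∀ k, A (b k) = (e k : ℂ) • b k) :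
    Tendsto (timeAvg P A ψ) atTop (𝓝 (∑ k, ‖⟪b k, ψ⟫_ℂ • P (b k)‖ ^ 2)) := by
  classical
  set v : ι → H := fun k => ⟪b k, ψ⟫_ℂ • P (b k) with hv
  have hP (t : ℝ) : P (evolve A t ψ) = ∑ k, Complex.exp (-(Complex.I * t) * e k) • v k := by
    conv_lhs => rw [← b.sum_repr ψ]
    have (k : ι) : evolve A t (b.repr ψ k • b k) =
        b.repr ψ k • Complex.exp (-(Complex.I * t) * e k) • b k := by
      rw [← evolve_eigenvector A (hb k)]
      simp only [evolve, map_smul]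
    have h2 : evolve A t (∑ k, b.repr ψ k • b k) = ∑ k, evolve A t (b.repr ψ k • b k) := by
      simp only [evolve, map_sum]
    rw [h2, map_sum]
    refine Finset.sum_congr rfl fun k _ => ?_
    rw [this, map_smul, map_smul, hv, smul_comm, b.repr_apply_apply]
  have hexp (t : ℝ) : ((‖P (evolve A t ψ)‖ ^ 2 : ℝ) : ℂ) =
      ∑ k, ∑ l, Complex.exp (((e k - e l : ℝ) : ℂ) * Complex.I * t) * ⟪v k, v l⟫_ℂ := by
    have hn (x : H) : ((‖x‖ ^ 2 : ℝ) : ℂ) = ⟪x, x⟫_ℂ := by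
      rw [inner_self_eq_norm_sq_to_K]; simp
    rw [hn, hP, sum_inner]
    refine Finset.sum_congr rfl fun k _ => ?_
    rw [inner_sum]
    refine Finset.sum_congr rfl fun l _ => ?_
    rw [inner_smul_left, inner_smul_right, ← mul_assoc, ← Complex.exp_conj, ← Complex.exp_add]
    congr 2
    simp
    ring
  have hlim : Tendsto (fun T : ℝ => ∑ k, ∑ l,
      (∫ t in (0 : ℝ)..T, Complex.exp (((e k - e l : ℝ) : ℂ) * Complex.I * t)) / T * ⟪v k, v l⟫_ℂ)
      atTop (𝓝 (∑ k, ∑ l, (if e k - e l = 0 then 1 else 0) * ⟪v k, v l⟫_ℂ)) :=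
    tendsto_finsetSum _ fun k _ => tendsto_finsetSum _ fun l _ =>
      (tendsto_avg_exp _).mul_const _
  have hval : ∑ k, ∑ l, (if e k - e l = 0 then 1 else 0) * ⟪v k, v l⟫_ℂ =
      ((∑ k, ‖v k‖ ^ 2 : ℝ) : ℂ) := by
    push_cast
    refine Finset.sum_congr rfl fun k _ => ?_
    simp only [sub_eq_zero, he.eq_iff, ite_mul, one_mul, zero_mul, Finset.sum_ite_eq,
      Finset.mem_univ, if_true]
    exact inner_self_eq_norm_sq_to_K _
  rw [hval] at hlim
  have hre := (Complex.continuous_re.tendsto _).comp hlim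
  rw [Complex.ofReal_re] at hre
  refine hre.congr fun T => ?_
  rw [Function.comp_apply, ← Complex.ofReal_re (timeAvg P A ψ T)]
  congr 1
  have hint (k l : ι) : IntervalIntegrable (fun t : ℝ =>
      Complex.exp (((e k - e l : ℝ) : ℂ) * Complex.I * t) * ⟪v k, v l⟫_ℂ) volume 0 T :=
    Continuous.intervalIntegrable (by fun_prop) _ _
  rw [timeAvg, Complex.ofReal_div, ← intervalIntegral.integral_ofReal]
  simp only [hexp]
  rw [intervalIntegral.integral_finsetSum fun k _ =>
    Continuous.intervalIntegrable (by fun_prop) _ _, Finset.sum_div]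
  refine Finset.sum_congr rfl fun k _ => ?_
  rw [intervalIntegral.integral_finsetSum fun l _ => hint k l, Finset.sum_div]
  refine Finset.sum_congr rfl fun l _ => ?_
  rw [intervalIntegral.integral_mul_const, div_mul_eq_mul_div]

/-- Markov's inequality for the fraction of time. -/
theorem forMostTimes_lt_of_tendsto {X : ℝ → ℝ} (hX : Continuous X) (h0 : ∀ t, 0 ≤ X t) {a c δ : ℝ}
    (hc : 0 < c) (ha : Tendsto (fun T : ℝ => (∫ t in (0 : ℝ)..T, X t) / T) atTop (𝓝 a))
    (hac : a ≤ c * δ) : ForMostTimes δ fun t => X t < c := by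
  have hm : MeasurableSet {t | X t < c} := (isOpen_Iio.preimage hX).measurableSet
  have hle (T : ℝ) (hT : 0 < T) : 1 - (∫ t in (0 : ℝ)..T, X t) / T / c ≤
      volume.real {t : ℝ | t ∈ Icc 0 T ∧ X t < c} / T := by
    have hint : IntegrableOn X (Icc 0 T) := hX.integrableOn_Icc
    have h1 := mul_meas_ge_le_integral_of_nonneg (μ := volume.restrict (Icc 0 T))
      (.of_forall h0) hint c
    rw [integral_Icc_eq_integral_Ioc, ← intervalIntegral.integral_of_le hT.le,
      measureReal_restrict_apply (measurableSet_le measurable_const hX.measurable)] at h1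
    have h2 : volume.real (Icc 0 T) = volume.real (Icc 0 T ∩ {t | X t < c}) +
        volume.real (Icc 0 T \ {t | X t < c}) :=
      (measureReal_inter_add_sdiff hm (by simp)).symm
    have h3 : Icc 0 T \ {t | X t < c} = {t | c ≤ X t} ∩ Icc 0 T := by
      ext t; simp [and_comm]
    rw [h3, Real.volume_real_Icc_of_le hT.le, sub_zero] at h2
    have h4 : {t : ℝ | t ∈ Icc 0 T ∧ X t < c} = Icc 0 T ∩ {t | X t < c} := rfl
    rw [h4, div_div, le_div_iff₀ hT, sub_mul, div_mul_eq_mul_div, mul_comm T c,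
      mul_div_mul_right _ _ hT.ne', one_mul]
    rw [mul_comm] at h1
    have := (le_div_iff₀ hc).2 h1
    linarith
  have hlim : Tendsto (fun T : ℝ => 1 - (∫ t in (0 : ℝ)..T, X t) / T / c) atTop (𝓝 (1 - a / c)) :=
    tendsto_const_nhds.sub (ha.div_const c)
  -- A real `liminf` is meaningful only with this bound; time fractions are at most `1`.
  have hb : IsCoboundedUnder (· ≥ ·) atTop
      fun T : ℝ => volume.real {t : ℝ | t ∈ Icc 0 T ∧ X t < c} / T := by
    refine (isBoundedUnder_of_eventually_le (a := 1) ?_).isCoboundedUnder_ge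
    filter_upwards [eventually_gt_atTop 0] with T hT
    rw [div_le_one hT]
    calc volume.real {t : ℝ | t ∈ Icc 0 T ∧ X t < c} ≤ volume.real (Icc 0 T) :=
          measureReal_mono (fun t ht => ht.1) (by simp)
      _ = T := by rw [Real.volume_real_Icc_of_le hT.le, sub_zero]
  calc 1 - δ ≤ 1 - a / c := by
        gcongr
        rw [div_le_iff₀ hc]
        linarith
    _ = liminf (fun T : ℝ => 1 - (∫ t in (0 : ℝ)..T, X t) / T / c) atTop := hlim.liminf_eq.symm
    _ ≤ _ := liminf_le_liminf
        ((eventually_gt_atTop 0).mono fun T hT => hle T hT) hlim.isBoundedUnder_ge hb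

end

/-! ### Fourth moments of random diagonal phases. -/

section

variable {H : Type*} [NormedAddCommGroup H] [InnerProductSpace ℂ H]

/-- The fourth roots of unity `i ^ g a`. -/
def phase {ι : Type*} (g : ι → ZMod 4) (a : ι) : ℂ := Complex.I ^ (g a).val

theorem norm_phase {ι : Type*} (g : ι → ZMod 4) (a : ι) : ‖phase g a‖ = 1 := by
  simp [phase]

theorem phase_add_single {ι : Type*} [DecidableEq ι] (g : ι → ZMod 4) (j a : ι) :
    phase (g + Pi.single j 1) a = (if a = j then Complex.I else 1) * phase g a := by
  have key : ∀ x : ZMod 4, Complex.I ^ (x + 1).val = Complex.I * Complex.I ^ x.val := by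
    intro x
    rw [← pow_succ', ZMod.val_add, ← Complex.I_pow_eq_pow_mod]
    rfl
  by_cases h : a = j
  · subst h
    simp [phase, key]
  · simp [phase, h]

/-- Each index occurs with exponent between `-2` and `2`, so its phase averages to zero unless the
exponent vanishes. Signs would not suffice, since their squares are trivial. For `p = p.swap` the
right side counts twice, which is harmless. -/
theorem norm_sum_phase_le {ι : Type*} [Fintype ι] [DecidableEq ι] (p q : ι × ι) :
    ‖∑ g : ι → ZMod 4, starRingEnd ℂ (phase g p.1 * phase g p.2) * (phase g q.1 * phase g q.2)‖ ≤
      Fintype.card (ι → ZMod 4) *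
        ((if q = p then 1 else 0) + (if q = p.swap then 1 else 0) : ℝ) := by
  by_cases h : q = p ∨ q = p.swap
  · refine (norm_sum_le _ _).trans ?_
    simp only [norm_mul, RCLike.norm_conj, norm_phase, mul_one, Finset.sum_const, nsmul_eq_mul,
      Finset.card_univ]
    refine le_mul_of_one_le_right (by positivity) ?_
    rcases h with h | h <;> simp only [h, if_true] <;> split_ifs <;> norm_num
  · obtain ⟨a, b⟩ := p
    obtain ⟨c, d⟩ := q
    set S := ∑ g : ι → ZMod 4, starRingEnd ℂ (phase g a * phase g b) * (phase g c * phase g d)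
      with hS
    let w (j x : ι) : ℂ := if x = j then Complex.I else 1
    -- Multiplying the `j`-th phase by `I` permutes the summation range and scales every term by the
    -- same factor, so `S = 0` once some factor differs from `1`.
    have hshift (j : ι) : S = starRingEnd ℂ (w j a * w j b) * (w j c * w j d) * S := by
      refine (Equiv.sum_comp (Equiv.addRight (Pi.single j (1 : ZMod 4))) _).symm.trans ?_
      rw [hS, Finset.mul_sum]
      refine Finset.sum_congr rfl fun g _ => ?_
      simp only [Equiv.coe_addRight, phase_add_single, map_mul, w]
      ring
    have hne : ∃ j, starRingEnd ℂ (w j a * w j b) * (w j c * w j d) ≠ 1 := by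
      by_contra! hall
      have ha := hall a
      have hb := hall b
      simp only [w, if_true] at ha hb
      simp only [Prod.mk.injEq, Prod.swap_prod_mk, not_or, not_and] at h
      by_cases hab : a = b
      · subst hab
        by_cases hca : c = a <;> by_cases hda : d = a <;>
          simp [hca, hda, Complex.ext_iff] at ha
        · exact h.1 hca hda
        · norm_num at ha
      · simp only [if_neg hab, if_neg (Ne.symm hab)] at ha hb
        by_cases hca : c = a
        · have hdb : d ≠ b := h.1 hca
          have hcb : c ≠ b := hca ▸ hab
          simp [hcb, hdb, Complex.ext_iff] at hb
        · by_cases hda : d = a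
          · have hcb : c ≠ b := fun h' => h.2 h' hda
            have hdb : d ≠ b := hda ▸ hab
            simp [hcb, hdb, Complex.ext_iff] at hb
          · simp [hca, hda, Complex.ext_iff] at ha
    obtain ⟨j, hj⟩ := hne
    have hS0 : S = 0 := by
      by_contra hne
      exact hj (mul_right_cancel₀ hne ((hshift j).symm.trans (one_mul S).symm))
    simp only [hS0, norm_zero]
    positivity

/-- The two surviving pairings `q = p` and `q = p.swap` produce the factor `2`, the second after
`2xy ≤ x² + y²`. -/
theorem sum_norm_sq_phase_le {ι : Type*} [Fintype ι] [DecidableEq ι]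
    (X : ι × ι → H) :
    ∑ g : ι → ZMod 4, ‖∑ p : ι × ι, (phase g p.1 * phase g p.2) • X p‖ ^ 2 ≤
      Fintype.card (ι → ZMod 4) * (2 * ∑ p, ‖X p‖ ^ 2) := by
  set N : ℝ := (Fintype.card (ι → ZMod 4) : ℝ)
  have hcalc : ((∑ g : ι → ZMod 4, ‖∑ p : ι × ι, (phase g p.1 * phase g p.2) • X p‖ ^ 2 : ℝ) : ℂ) =
      ∑ p, ∑ q, (∑ g : ι → ZMod 4,
        starRingEnd ℂ (phase g p.1 * phase g p.2) * (phase g q.1 * phase g q.2)) *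
          ⟪X p, X q⟫_ℂ := by
    have hn (x : H) : ((‖x‖ ^ 2 : ℝ) : ℂ) = ⟪x, x⟫_ℂ := by
      rw [inner_self_eq_norm_sq_to_K]; simp
    rw [Complex.ofReal_sum]
    simp only [hn, Finset.sum_mul]
    have hg (g : ι → ZMod 4) : ⟪∑ p : ι × ι, (phase g p.1 * phase g p.2) • X p,
        ∑ p : ι × ι, (phase g p.1 * phase g p.2) • X p⟫_ℂ = ∑ p : ι × ι, ∑ q : ι × ι,
          starRingEnd ℂ (phase g p.1 * phase g p.2) * (phase g q.1 * phase g q.2) *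
            ⟪X p, X q⟫_ℂ := by
      rw [sum_inner]
      refine Finset.sum_congr rfl fun p _ => ?_
      rw [inner_sum]
      refine Finset.sum_congr rfl fun q _ => ?_
      rw [inner_smul_left, inner_smul_right, ← mul_assoc]
    simp only [hg]
    rw [Finset.sum_comm]
    exact Finset.sum_congr rfl fun p _ => Finset.sum_comm
  have hswap : ∑ p : ι × ι, ‖X p.swap‖ ^ 2 = ∑ p, ‖X p‖ ^ 2 :=
    (Equiv.prodComm ι ι).sum_comp fun p => ‖X p‖ ^ 2
  calc ∑ g : ι → ZMod 4, ‖∑ p : ι × ι, (phase g p.1 * phase g p.2) • X p‖ ^ 2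
      = ‖((∑ g : ι → ZMod 4,
          ‖∑ p : ι × ι, (phase g p.1 * phase g p.2) • X p‖ ^ 2 : ℝ) : ℂ)‖ := by
        rw [Complex.norm_real, Real.norm_of_nonneg (by positivity)]
    _ ≤ ∑ p, ∑ q, N * ((if q = p then 1 else 0) + (if q = p.swap then 1 else 0) : ℝ) *
          (‖X p‖ * ‖X q‖) := by
        rw [hcalc]
        refine (norm_sum_le _ _).trans (Finset.sum_le_sum fun p _ => (norm_sum_le _ _).trans
          (Finset.sum_le_sum fun q _ => ?_))
        rw [norm_mul]
        exact mul_le_mul (norm_sum_phase_le p q) (norm_inner_le_norm _ _) (norm_nonneg _)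
          (by positivity)
    _ = ∑ p, N * (‖X p‖ * ‖X p‖ + ‖X p‖ * ‖X p.swap‖) := by
        refine Finset.sum_congr rfl fun p _ => ?_
        simp only [mul_assoc, add_mul, ← Finset.mul_sum, Finset.sum_add_distrib, ite_mul, one_mul,
          zero_mul, Finset.sum_ite_eq', Finset.mem_univ, if_true]
    _ ≤ ∑ p, N * (3 / 2 * ‖X p‖ ^ 2 + 1 / 2 * ‖X p.swap‖ ^ 2) := by
        refine Finset.sum_le_sum fun p _ => mul_le_mul_of_nonneg_left ?_ (by positivity)
        nlinarith [sq_nonneg (‖X p‖ - ‖X p.swap‖)]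
    _ = N * (2 * ∑ p, ‖X p‖ ^ 2) := by
        rw [← Finset.mul_sum, Finset.sum_add_distrib, ← Finset.mul_sum, ← Finset.mul_sum, hswap]
        ring

/-- Averaging over diagonal phases in the basis `φ`, the mean of the long-time average of
`‖P ψ_t‖²` is at most twice the largest `‖P φ_k‖²`. -/
theorem sum_phase_timeAvg_le {ι : Type*} [Fintype ι] [DecidableEq ι]
    (φ b : OrthonormalBasis ι ℂ H) (P : H →L[ℂ] H) (ψ : H) {ε : ℝ}
    (hε : ∀ k, ‖P (φ k)‖ ^ 2 ≤ ε) :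
    ∑ g : ι → ZMod 4, ∑ k,
        ‖⟪diagOp φ (phase g) (b k), ψ⟫_ℂ • P (diagOp φ (phase g) (b k))‖ ^ 2 ≤
      Fintype.card (ι → ZMod 4) * (2 * (ε * ‖ψ‖ ^ 2)) := by
  let X (k : ι) (p : ι × ι) : H :=
    (⟪ψ, φ p.1⟫_ℂ * ⟪φ p.1, b k⟫_ℂ * ⟪φ p.2, b k⟫_ℂ) • P (φ p.2)
  have hX (g : ι → ZMod 4) (k : ι) :
      ‖⟪diagOp φ (phase g) (b k), ψ⟫_ℂ • P (diagOp φ (phase g) (b k))‖ =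
        ‖∑ p : ι × ι, (phase g p.1 * phase g p.2) • X k p‖ := by
    -- Flipping the inner product inside the norm makes both phases appear unconjugated.
    rw [norm_smul, norm_inner_symm, ← norm_smul]
    congr 1
    simp only [diagOp_apply, inner_sum, map_sum, map_smul, inner_smul_right, Finset.sum_smul_sum,
      X, smul_smul, Fintype.sum_prod_type]
    refine Finset.sum_congr rfl fun a _ => Finset.sum_congr rfl fun c _ => ?_
    congr 1
    ring
  have hsum : ∑ k, ∑ p, ‖X k p‖ ^ 2 ≤ ε * ‖ψ‖ ^ 2 := by
    calc ∑ k, ∑ p, ‖X k p‖ ^ 2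
        = ∑ k, ∑ a, ∑ c, ‖⟪ψ, φ a⟫_ℂ‖ ^ 2 * ‖⟪φ a, b k⟫_ℂ‖ ^ 2 *
            (‖⟪φ c, b k⟫_ℂ‖ ^ 2 * ‖P (φ c)‖ ^ 2) := by
          refine Finset.sum_congr rfl fun k _ => ?_
          rw [Fintype.sum_prod_type]
          refine Finset.sum_congr rfl fun a _ => Finset.sum_congr rfl fun c _ => ?_
          simp only [X, norm_smul, norm_mul]
          ring
      _ ≤ ∑ k, ∑ a, ∑ c, ‖⟪ψ, φ a⟫_ℂ‖ ^ 2 * ‖⟪φ a, b k⟫_ℂ‖ ^ 2 *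
            (‖⟪φ c, b k⟫_ℂ‖ ^ 2 * ε) := by
          gcongr with k _ a _ c _
          exact hε c
      _ = ∑ k, ∑ a, ‖⟪ψ, φ a⟫_ℂ‖ ^ 2 * ‖⟪φ a, b k⟫_ℂ‖ ^ 2 * ε := by
          refine Finset.sum_congr rfl fun k _ => Finset.sum_congr rfl fun a _ => ?_
          rw [← Finset.mul_sum, ← Finset.sum_mul, φ.sum_sq_norm_inner_right, b.norm_eq_one]
          ring
      _ = ε * ‖ψ‖ ^ 2 := by
          rw [Finset.sum_comm]
          simp only [← Finset.sum_mul, ← Finset.mul_sum, b.sum_sq_norm_inner_left, φ.norm_eq_one]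
          rw [one_pow]
          simp only [mul_one]
          rw [φ.sum_sq_norm_inner_left, mul_comm]
  calc _ = ∑ k, ∑ g : ι → ZMod 4, ‖∑ p : ι × ι, (phase g p.1 * phase g p.2) • X k p‖ ^ 2 := by
        rw [Finset.sum_comm]
        simp only [hX]
    _ ≤ ∑ k, Fintype.card (ι → ZMod 4) * (2 * ∑ p, ‖X k p‖ ^ 2) :=
        Finset.sum_le_sum fun k _ => sum_norm_sq_phase_le (X k)
    _ = Fintype.card (ι → ZMod 4) * (2 * ∑ k, ∑ p, ‖X k p‖ ^ 2) := by
        rw [← Finset.mul_sum, ← Finset.mul_sum]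
    _ ≤ _ := by gcongr

end

/-! ### Averaging over the law of `V`. -/

section

variable {H : Type*} [NormedAddCommGroup H] [InnerProductSpace ℂ H] [CompleteSpace H]

/-- The unitary that is diagonal in the basis `φ` with diagonal entries `phase g`. -/
def phaseUnitary {ι : Type*} [Fintype ι] (φ : OrthonormalBasis ι ℂ H) (g : ι → ZMod 4) :
    unitary (H →L[ℂ] H) :=
  ⟨diagOp φ (phase g), by
    have h : star (phase g) * phase g = 1 := by
      ext a
      simp [← Complex.normSq_eq_conj_mul_self, Complex.normSq_eq_norm_sq, norm_phase]
    rw [Unitary.mem_iff, star_diagOp, diagOp_mul, diagOp_mul, mul_comm (phase g), h, diagOp_one]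
    exact ⟨rfl, rfl⟩⟩

theorem commute_phaseUnitary {ι : Type*} [Fintype ι] (φ : OrthonormalBasis ι ℂ H)
    (g : ι → ZMod 4) (H₀ : H →L[ℂ] H) (hφ : ∀ k, ∃ e : ℝ, H₀ (φ k) = (e : ℂ) • φ k) :
    Commute (phaseUnitary φ g : H →L[ℂ] H) H₀ :=
  clm_ext_basis φ fun k => by
    obtain ⟨e, he⟩ := hφ k
    simp only [phaseUnitary, mul_apply_eq_comp, he, map_smul, diagOp_basis]
    rw [smul_comm]

theorem continuous_conj (U : unitary (H →L[ℂ] H)) : Continuous (conj U) := by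
  refine Continuous.subtype_mk ?_ _
  fun_prop

theorem conj_apply_eigenvector (U : unitary (H →L[ℂ] H)) {H₀ : H →L[ℂ] H}
    (hU : Commute (U : H →L[ℂ] H) H₀) (lam : ℂ) (V : selfAdjoint (H →L[ℂ] H)) {v : H} {e : ℂ}
    (hv : (H₀ + lam • (V : H →L[ℂ] H)) v = e • v) :
    (H₀ + lam • (conj U V : H →L[ℂ] H)) ((U : H →L[ℂ] H) v) = e • (U : H →L[ℂ] H) v := by
  have h : (H₀ + lam • (conj U V : H →L[ℂ] H)) * (U : H →L[ℂ] H) =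
      (U : H →L[ℂ] H) * (H₀ + lam • (V : H →L[ℂ] H)) := by
    have hs : star (U : H →L[ℂ] H) * (U : H →L[ℂ] H) = 1 := Unitary.coe_star_mul_self U
    simp only [conj]
    rw [add_mul, mul_add, hU.eq, smul_mul_assoc, mul_assoc, hs, mul_one, mul_smul_comm]
  have h2 := congrArg (fun B : H →L[ℂ] H => B v) h
  simp only [mul_apply_eq_comp] at h2
  rw [h2, hv, map_smul]

/-- The long-time average of `‖P ψ_t‖²` for the Hamiltonian `H₀ + lam V`. -/
def longTimeAvg (P H₀ : H →L[ℂ] H) (ψ : H) (lam : ℂ) (V : selfAdjoint (H →L[ℂ] H)) : ENNReal :=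
  limsup (fun n : ℕ => ENNReal.ofReal (timeAvg P (H₀ + lam • (V : H →L[ℂ] H)) ψ n)) atTop

/-- Defining the average as a `limsup` over integer times gives measurability without a measurable
choice of eigenbasis. -/
theorem measurable_longTimeAvg (P H₀ : H →L[ℂ] H) (ψ : H) (lam : ℂ) :
    Measurable (longTimeAvg P H₀ ψ lam) := by
  refine Measurable.limsup fun n => ENNReal.measurable_ofReal.comp ?_
  refine Continuous.measurable ?_
  unfold timeAvg
  refine Continuous.div_const ?_ _
  refine intervalIntegral.continuous_parametric_intervalIntegral_of_continuous' ?_ _ _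
  have h : Continuous fun p : selfAdjoint (H →L[ℂ] H) × ℝ =>
      evolve (H₀ + lam • (p.1 : H →L[ℂ] H)) p.2 ψ :=
    continuous_evolve.comp (f := fun p : selfAdjoint (H →L[ℂ] H) × ℝ =>
      (H₀ + lam • (p.1 : H →L[ℂ] H), p.2, ψ)) (by fun_prop)
  exact (P.continuous.comp h).norm.pow 2

theorem longTimeAvg_eq {ι : Type*} [Fintype ι] (P H₀ : H →L[ℂ] H) (ψ : H) (lam : ℂ)
    (V : selfAdjoint (H →L[ℂ] H)) (b : OrthonormalBasis ι ℂ H) (e : ι → ℝ)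
    (he : Function.Injective e)
    (hb : ∀ k, (H₀ + lam • (V : H →L[ℂ] H)) (b k) = (e k : ℂ) • b k) :
    longTimeAvg P H₀ ψ lam V = ENNReal.ofReal (∑ k, ‖⟪b k, ψ⟫_ℂ • P (b k)‖ ^ 2) :=
  ((ENNReal.continuous_ofReal.tendsto _).comp
    ((tendsto_timeAvg P _ ψ b e he hb).comp tendsto_natCast_atTop_atTop)).limsup_eq

theorem exists_eigenbasis [FiniteDimensional ℂ H]
    (φ : OrthonormalBasis (Fin (Module.finrank ℂ H)) ℂ H) (w : H)
    {A : H →L[ℂ] H} (hA : IsSelfAdjoint A) (h : (krylov φ w A).det ≠ 0) :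
    ∃ (b : OrthonormalBasis (Fin (Module.finrank ℂ H)) ℂ H)
      (e : Fin (Module.finrank ℂ H) → ℝ), Function.Injective e ∧
        ∀ k, A (b k) = (e k : ℂ) • b k := by
  have hs := hA.isSymmetric
  refine ⟨hs.eigenvectorBasis rfl, hs.eigenvalues rfl, ?_, hs.apply_eigenvectorBasis rfl⟩
  exact eigenvalues_injective_of_krylov φ _ w hA h _ (hs.apply_eigenvectorBasis rfl)

theorem isSelfAdjoint_perturbed {H₀ : H →L[ℂ] H} (hH₀ : IsSelfAdjoint H₀) (lam : ℝ)
    (V : selfAdjoint (H →L[ℂ] H)) : IsSelfAdjoint (H₀ + (lam : ℂ) • (V : H →L[ℂ] H)) :=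
  hH₀.add (IsSelfAdjoint.smul (by simp [isSelfAdjoint_iff]) V.2)

theorem lintegral_longTimeAvg_le [FiniteDimensional ℂ H] {H₀ : H →L[ℂ] H}
    (hH₀ : IsSelfAdjoint H₀) {ε : ℝ} (P : H →L[ℂ] H)
    (φ : OrthonormalBasis (Fin (Module.finrank ℂ H)) ℂ H)
    (hφ : ∀ k, ∃ e : ℝ, H₀ (φ k) = (e : ℂ) • φ k) (hε : ∀ k, ‖P (φ k)‖ ^ 2 ≤ ε)
    (μ : Measure (selfAdjoint (H →L[ℂ] H))) [IsProbabilityMeasure μ]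
    (hμ : ContinuousLaw μ) (hinv : InvariantLaw H₀ μ) {lam : ℝ} (hlam : lam ≠ 0) {ψ : H}
    (hψ : ‖ψ‖ = 1) :
    ∫⁻ V, longTimeAvg P H₀ ψ lam V ∂μ ≤ ENNReal.ofReal (2 * ε) := by
  let G := Fin (Module.finrank ℂ H) → ZMod 4
  set F := longTimeAvg P H₀ ψ (lam : ℂ) with hF
  have hFm : Measurable F := measurable_longTimeAvg P H₀ ψ lam
  have hcomm (g : G) := commute_phaseUnitary φ g H₀ hφ
  have hg (g : G) : ∫⁻ V, F (conj (phaseUnitary φ g) V) ∂μ = ∫⁻ V, F V ∂μ := by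
    rw [← lintegral_map hFm (continuous_conj _).measurable, hinv _ (hcomm g)]
  have hpt : ∀ᵐ V ∂μ, ∑ g : G, F (conj (phaseUnitary φ g) V) ≤
      ENNReal.ofReal (Fintype.card G * (2 * ε)) := by
    filter_upwards [ae_selfAdjoint_krylov_det_ne_zero φ H₀ hlam hμ] with V hV
    obtain ⟨b, e, he, hb⟩ := exists_eigenbasis φ _ (isSelfAdjoint_perturbed hH₀ lam V) hV
    -- Conjugation moves the eigenbasis to `U b` and keeps the simple eigenvalues, so one `b` serves
    -- all `g`.
    have hFg (g : G) : F (conj (phaseUnitary φ g) V) = ENNReal.ofReal (∑ k,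
        ‖⟪diagOp φ (phase g) (b k), ψ⟫_ℂ • P (diagOp φ (phase g) (b k))‖ ^ 2) :=
      longTimeAvg_eq P H₀ ψ lam _ (b.map (Unitary.linearIsometryEquiv (phaseUnitary φ g))) e he
        fun k => conj_apply_eigenvector (phaseUnitary φ g) (hcomm g) lam V (hb k)
    simp only [hFg]
    rw [← ENNReal.ofReal_sum_of_nonneg fun _ _ => by positivity]
    refine ENNReal.ofReal_le_ofReal ((sum_phase_timeAvg_le φ b P ψ hε).trans_eq ?_)
    rw [hψ]
    ring
  have hsum : (Fintype.card G : ENNReal) * ∫⁻ V, F V ∂μ ≤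
      Fintype.card G * ENNReal.ofReal (2 * ε) := by
    calc (Fintype.card G : ENNReal) * ∫⁻ V, F V ∂μ
        = ∑ g : G, ∫⁻ V, F (conj (phaseUnitary φ g) V) ∂μ := by simp [hg]
      _ = ∫⁻ V, ∑ g : G, F (conj (phaseUnitary φ g) V) ∂μ :=
          (lintegral_finsetSum _ fun g _ => hFm.comp (continuous_conj _).measurable).symm
      _ ≤ ∫⁻ _, ENNReal.ofReal (Fintype.card G * (2 * ε)) ∂μ := lintegral_mono_ae hpt
      _ = Fintype.card G * ENNReal.ofReal (2 * ε) := by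
          rw [lintegral_const, measure_univ, mul_one, ENNReal.ofReal_mul (by positivity),
            ENNReal.ofReal_natCast]
  exact (ENNReal.mul_le_mul_iff_right (by simp) (by simp)).1 hsum

end

end Thermalization

end

/-! ### Conclusion by Markov's inequality in `V` and in `t`. -/

theorem mainTheorem7 {H : Type*} [NormedAddCommGroup H] [InnerProductSpace ℂ H]
    [FiniteDimensional ℂ H] [CompleteSpace H]
    (Heq : Submodule ℂ H)
    (H₀ : H →L[ℂ] H) (hH₀ : IsSelfAdjoint H₀)
    (ε : ℝ) (hε : 0 < ε)
    (φ : OrthonormalBasis (Fin (Module.finrank ℂ H)) ℂ H)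
    (hφ : ∀ k, ∃ e : ℝ, H₀ (φ k) = (e : ℂ) • φ k)
    (hφε : ∀ k, ‖Thermalization.Pneq Heq (φ k)‖ ^ 2 < ε)
    (μ : Measure (selfAdjoint (H →L[ℂ] H))) [IsProbabilityMeasure μ]
    (hμ : Thermalization.ContinuousLaw μ)
    (hinv : Thermalization.InvariantLaw H₀ μ)
    (δ δ' : ℝ) (hδ : 0 < δ) (hδ' : 0 < δ') :
    ∃ lam₀ : ℝ, 0 < lam₀ ∧ ∀ lam ∈ Ioo 0 lam₀, ∀ ψ₀ ∈ Metric.sphere (0 : H) 1,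
      Thermalization.ForMost μ δ fun V =>
        Thermalization.ForMostTimes δ' fun t =>
          ‖Thermalization.Pneq Heq
            (Thermalization.evolve (H₀ + (lam : ℂ) • (V : H →L[ℂ] H)) t ψ₀)‖ ^ 2
            < 3 * ε / (δ * δ') := by
  -- Any positive bound would do; only `lam ≠ 0` matters.
  refine ⟨1, one_pos, fun lam hlam ψ₀ hψ₀ => ?_⟩
  have hψ : ‖ψ₀‖ = 1 := by simpa using hψ₀
  have hlam0 : lam ≠ 0 := hlam.1.ne'
  set P := Thermalization.Pneq Heq
  set F := Thermalization.longTimeAvg P H₀ ψ₀ (lam : ℂ)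
  have hFm : Measurable F := Thermalization.measurable_longTimeAvg P H₀ ψ₀ lam
  have hcont : Continuous fun V : selfAdjoint (H →L[ℂ] H) =>
      (Thermalization.krylov φ (∑ k, φ k) (H₀ + (lam : ℂ) • (V : H →L[ℂ] H))).det :=
    (Thermalization.continuous_krylov_det φ _).comp (by fun_prop)
  set D : Set (selfAdjoint (H →L[ℂ] H)) := {V |
    (Thermalization.krylov φ (∑ k, φ k) (H₀ + (lam : ℂ) • (V : H →L[ℂ] H))).det ≠ 0} with hD
  have hDm : MeasurableSet D := (isOpen_compl_singleton.preimage hcont).measurableSet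
  have hDae : ∀ᵐ V ∂μ, V ∈ D := Thermalization.ae_selfAdjoint_krylov_det_ne_zero φ H₀ hlam0 hμ
  set r : ENNReal := ENNReal.ofReal (3 * ε / δ) with hr
  have hr0 : 0 < 3 * ε / δ := by positivity
  have hE : MeasurableSet {V | F V < r} := measurableSet_lt hFm measurable_const
  -- On `D`, a set of full measure, `F` is a genuine limit over real times.
  refine ⟨{V | F V < r} ∩ D, hE.inter hDm, ?_, ?_⟩
  · rintro V ⟨hV, hVD⟩
    obtain ⟨b, e, he, hb⟩ := Thermalization.exists_eigenbasis φ _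
      (Thermalization.isSelfAdjoint_perturbed hH₀ lam V) hVD
    have hFV : F V < r := hV
    rw [show F V = _ from Thermalization.longTimeAvg_eq P H₀ ψ₀ lam V b e he hb, hr,
      ENNReal.ofReal_lt_ofReal_iff hr0] at hFV
    refine Thermalization.forMostTimes_lt_of_tendsto
      (X := fun t => ‖P (Thermalization.evolve (H₀ + (lam : ℂ) • (V : H →L[ℂ] H)) t ψ₀)‖ ^ 2)
      ?_ (fun t => by positivity) (by positivity)
      (Thermalization.tendsto_timeAvg P _ ψ₀ b e he hb) (hFV.le.trans_eq ?_)
    · exact (P.continuous.comp (Thermalization.continuous_evolve.comp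
        (f := fun t : ℝ => (H₀ + (lam : ℂ) • (V : H →L[ℂ] H), t, ψ₀)) (by fun_prop))).norm.pow 2
    · field_simp
  · have hint := Thermalization.lintegral_longTimeAvg_le hH₀ P φ hφ (fun k => (hφε k).le) μ hμ hinv
      hlam0 hψ
    -- Markov gives `2ε / (3ε/δ) = 2δ/3`, which is below `δ`.
    have hbad : μ {V | r ≤ F V} ≤ ENNReal.ofReal δ := by
      refine (meas_ge_le_lintegral_div hFm.aemeasurable (by simpa [hr] using hr0)
        ENNReal.ofReal_ne_top).trans ?_
      refine (ENNReal.div_le_div_right hint _).trans ?_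
      rw [← ENNReal.ofReal_div_of_pos hr0]
      refine ENNReal.ofReal_le_ofReal ?_
      rw [div_le_iff₀ hr0]
      field_simp
      norm_num
    have hcompl : {V | r ≤ F V} = {V | F V < r}ᶜ := by ext V; simp
    rw [hcompl, prob_compl_eq_one_sub hE] at hbad
    have hinter : μ ({V | F V < r} ∩ D) = μ {V | F V < r} :=
      measure_congr (inter_ae_eq_left_of_ae_eq_univ (eventuallyEq_univ.2 hDae))
    rw [hinter, ENNReal.ofReal_sub _ hδ.le, ENNReal.ofReal_one, tsub_le_iff_right]
    rw [tsub_le_iff_right] at hbad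
    rwa [add_comm]
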